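/- Let $d\ge 1$, let $f\in\mathcal D'(\mathbb R^d)$ be a (real or complex) distribution and let $x_0\in\mathbb R^d$. Let $\mathbb S$ be the unit sphere of $\mathbb R^d$ and $\mathcal D'(\mathbb S)$ the dual of $C^\infty(\mathbb S)$. One says that $f$ has the thick distributional point value $\alpha\in\mathcal D'(\mathbb S)$ at $x_0$ if, for every test function $\phi\in\mathcal D(\mathbb R^d)$, $$\lim_{\varepsilon\to 0^+}\langle f(x_0+\varepsilon x),\phi(x)\rangle=\int_0^\infty\langle\alpha(w),\phi(rw)\rangle_{\mathcal D'(\mathbb S)\times\mathcal D(\mathbb S)}\,r^{d-1}\,dr ,$$ where $\langle f(x_0+\varepsilon x),\phi(x)\rangle=\langle f(y),\varepsilon^{-d}\phi((y-x_0)/\varepsilon)\rangle$. Then $f$ has a thick distributional point value at $x_0$ (that is, such an $\alpha\in\mathcal D'(\mathbb S)$ exists) if and only if, for every $\phi\in\mathcal D(\mathbb R^d)$ with $\phi\ge 0$ and $\int_{\mathbb R^d}\phi(x)\,dx=1$, the limit $$\lim_{n\to\infty}\langle f(x_0+x),\,n^d\phi(nx)\rangle$$ exists (as a finite number, which is allowed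 to depend on $\phi$). -/

import Mathlib

open scoped Manifold ContDiff Distributions
open Metric Filter Topology MeasureTheory TopologicalSpace

noncomputable section

namespace ThickValue

/-- Euclidean space `ℝ^d`. -/
abbrev Rn (d : ℕ) : Type := EuclideanSpace ℝ (Fin d)

/-- The unit sphere `𝕊` of `ℝ^d`. -/
abbrev Sph (d : ℕ) : Type := sphere (0 : Rn d) 1

/-- The space `𝒟(ℝ^d)` of (real-valued) smooth test functions with compact support. -/
abbrev TestFn (d : ℕ) : Type := 𝓓((⊤ : Opens (Rn d)), ℝ)

/-- The space `𝒟'(ℝ^d)` of scalar distributions. With `𝕜 = ℂ` these are the complex distributions: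
a continuous `ℝ`-linear map from real test functions to `ℂ` is the same thing as a continuous
`ℂ`-linear form on complex test functions. -/
abbrev Distr (d : ℕ) (𝕜 : Type*) [RCLike 𝕜] : Type _ := 𝓓'((⊤ : Opens (Rn d)), 𝕜)

instance fact_finrank (d : ℕ) [NeZero d] : Fact (Module.finrank ℝ (Rn d) = (d - 1) + 1) :=
  ⟨by have := NeZero.pos d; rw [finrank_euclideanSpace_fin]; omega⟩

/-- The space `𝒟(𝕊) = C^∞(𝕊)` of smooth functions on the unit sphere of `ℝ^d`, `d ≥ 1`. -/
abbrev SphTestFn (d : ℕ) [NeZero d] : Type :=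
  C^∞⟮𝓡 (d - 1), Sph d; 𝓘(ℝ, ℝ), ℝ⟯

/-- The extension of a function on the sphere to `ℝ^d` that is homogeneous of degree `0`,
`x ↦ ψ (x / ‖x‖)` (with value `0` at the origin). -/
def homExt {d : ℕ} (ψ : Sph d → ℝ) (x : Rn d) : ℝ :=
  if hx : x ≠ 0 then
    ψ ⟨‖x‖⁻¹ • x, by
      rw [mem_sphere_zero_iff_norm, norm_smul, norm_inv, norm_norm,
        inv_mul_cancel₀ (norm_ne_zero_iff.mpr hx)]⟩
  else 0

/-- The `C^N` norm on `𝒟(𝕊)`: the sum over `k ≤ N` of the maximum over the sphere of the norm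
of the `k`-th derivative of the homogeneous extension of degree `0`. These norms
define the usual Fréchet topology of `C^∞(𝕊)`. (The extension is smooth off the origin and the
sphere is compact, so each supremum is a maximum of a continuous function.) -/
def sphNorm {d : ℕ} [NeZero d] (N : ℕ) (ψ : SphTestFn d) : ℝ :=
  ∑ k ∈ Finset.range (N + 1), ⨆ w : Sph d, ‖iteratedFDeriv ℝ k (homExt ψ) (w : Rn d)‖

/-- A distribution on the unit sphere, i.e. an element of `𝒟'(𝕊)`: a linear functional on
`C^∞(𝕊)` that is continuous, i.e. bounded by a multiple of some `C^N` norm. -/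
structure SphDistr (d : ℕ) [NeZero d] (𝕜 : Type*) [RCLike 𝕜] where
  /-- The underlying linear functional. -/
  toLinearMap : SphTestFn d →ₗ[ℝ] 𝕜
  /-- Continuity for the topology of uniform convergence of all derivatives. -/
  continuous' : ∃ (N : ℕ) (C : ℝ), ∀ ψ : SphTestFn d, ‖toLinearMap ψ‖ ≤ C * sphNorm N ψ

/-- The translated test function `x ↦ φ (x - x₀)`. -/
def translate {d : ℕ} (x₀ : Rn d) (φ : TestFn d) : TestFn d where
  toFun x := φ (x - x₀)
  contDiff' := φ.contDiff.comp (contDiff_id.sub contDiff_const)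
  hasCompactSupport' := φ.hasCompactSupport.comp_homeomorph (Homeomorph.subRight x₀)
  tsupport_subset' := by simp

/-- The dilated test function `x ↦ φ (a x)`, for `a ≠ 0` (and the junk value `0` for `a = 0`). -/
def dilate {d : ℕ} (a : ℝ) (φ : TestFn d) : TestFn d where
  toFun x := if a = 0 then 0 else φ (a • x)
  contDiff' := by
    by_cases ha : a = 0
    · simp only [ha, if_true]; exact contDiff_const
    · simp only [ha, if_false]; exact φ.contDiff.comp (contDiff_const_smul a)
  hasCompactSupport' := by
    by_cases ha : a = 0
    · simp only [ha, if_true]; exact HasCompactSupport.zero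
    · simp only [ha, if_false]
      exact φ.hasCompactSupport.comp_homeomorph (Homeomorph.smulOfNeZero a ha)
  tsupport_subset' := by simp

/-- The pairing `⟨f(x₀ + x), φ(x)⟩ = ⟨f(y), φ(y - x₀)⟩`. -/
def pairTranslate {d : ℕ} {𝕜 : Type*} [RCLike 𝕜] (f : Distr d 𝕜) (x₀ : Rn d) (φ : TestFn d) : 𝕜 :=
  f (translate x₀ φ)

/-- The pairing `⟨f(x₀ + ε x), φ(x)⟩ = ⟨f(y), ε^{-d} φ((y - x₀) / ε)⟩`, for `ε > 0`. -/
def pairRescale {d : ℕ} {𝕜 : Type*} [RCLike 𝕜] (f : Distr d 𝕜) (x₀ : Rn d) (ε : ℝ)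
    (φ : TestFn d) : 𝕜 :=
  f ((ε ^ d)⁻¹ • translate x₀ (dilate ε⁻¹ φ))

/-- The function `w ↦ φ (r w)` on the sphere. -/
def sphRestrict {d : ℕ} [NeZero d] (φ : TestFn d) (r : ℝ) : SphTestFn d :=
  ⟨fun w => φ (r • (w : Rn d)),
    (φ.contDiff.comp (contDiff_const_smul r)).contMDiff.comp contMDiff_coe_sphere⟩

/-- The homogeneous distribution of degree `0` on `ℝ^d` given by `α ∈ 𝒟'(𝕊)`,
`⟨g, φ⟩ = ∫₀^∞ ⟨α(w), φ(r w)⟩ r^{d-1} dr`. -/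
def homPairing {d : ℕ} [NeZero d] {𝕜 : Type*} [RCLike 𝕜] (α : SphDistr d 𝕜) (φ : TestFn d) : 𝕜 :=
  ∫ r in Set.Ioi (0 : ℝ), (r ^ (d - 1)) • α.toLinearMap (sphRestrict φ r)

/-- `α ∈ 𝒟'(𝕊)` is the thick distributional value of `f` at `x₀`: as `ε → 0⁺`, the distributions
`f(x₀ + ε x)` converge in `𝒟'(ℝ^d)` to the homogeneous distribution of degree `0` given by `α`.
Convergence against all test functions on `ℝ^d`, not only those vanishing near the origin, contains
the requirement that `f` has no delta functions at `x₀`. -/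
def HasThickValue {d : ℕ} [NeZero d] {𝕜 : Type*} [RCLike 𝕜] (f : Distr d 𝕜) (x₀ : Rn d)
    (α : SphDistr d 𝕜) : Prop :=
  ∀ φ : TestFn d, Tendsto (fun ε : ℝ => pairRescale f x₀ ε φ) (𝓝[>] 0) (𝓝 (homPairing α φ))

/-- A positive normalized test function: `φ ≥ 0` and `∫ φ = 1`. -/
def IsPosNormalized {d : ℕ} (φ : TestFn d) : Prop :=
  (∀ x, 0 ≤ φ x) ∧ ∫ x, φ x = 1

/-- The standard delta sequence generated by `φ`: `φ_n(x) = n^d φ(n x)`, for `n ≥ 1`. -/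
def stdDeltaSeq {d : ℕ} (φ : TestFn d) (n : ℕ) : TestFn d :=
  ((n : ℝ) ^ d) • dilate (n : ℝ) φ

end ThickValue

end

/-! The forward direction is the specialization `ε = 1/n`. For the converse, let `T n φ = ⟨f(x₀ +
x), n^d φ(n x)⟩`. Every test function is a difference of two nonnegative ones with positive
integral, so `T n φ` converges for all `φ` to some linear `L φ`. Each space `𝓓_K` is complete and
metrizable, hence Baire, and Banach–Steinhaus makes the `T n` equibounded in some `C^N` norm on each
compact set (`LocallyEquibounded.of_pointwise`); in particular `L` is a distribution.

Equiboundedness also upgrades the limit over integers to one over real `ε → 0⁺`: with `n = ⌊1/ε⌋`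
and `t = 1/(nε) → 1`, the rescaled pairing equals `t^d T n (φ(t ·))`, and `φ(t ·) → φ` in `𝒟`
(`tendsto_pairRescale`). Comparing the limits along `ε` and `ε/t` gives `L(φ(t ·)) = t^{-d} L φ`.

It remains to represent a homogeneous `L` by a distribution on the sphere (`exists_homPairing_eq`).
Take a cutoff `χ` equal to 1 on the unit ball and put `Q = -x · ∇χ`. By Euler's equation `s^d L(χ
φ(s ·))` has derivative `s^(d-1) L(Q φ(s ·))`; integrating from 0 to a radius `R` beyond which `φ`
vanishes gives `L φ = ∫ s^(d-1) L(Q φ(s ·)) ds`. Since `Q` vanishes in the open unit ball, the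
substitution `r = s‖x‖` inside `L` turns this into `∫ r^(d-1) α(φ(r ·)) dr` with `α(ψ) = L(Q(x)
‖x‖^{-d} ψ(x/‖x‖))`. -/

noncomputable section

namespace ThickValue

/-! ### Completeness and the Baire property of `𝓓_K`. -/

section Completeness

variable {E F : Type*} [NormedAddCommGroup E] [NormedSpace ℝ E]
  [NormedAddCommGroup F] [NormedSpace ℝ F]

/-- The range of the embedding of `𝓓_K` into the product of the spaces of bounded continuous
functions is closed. -/
theorem isClosed_range_structureMaps (K : Compacts E) :
    IsClosed (Set.range (ContinuousLinearMap.pi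
      (ContDiffMapSupportedIn.structureMapCLM ℝ ⊤) :
      𝓓_{K}(E, F) →L[ℝ] ∀ i : ℕ, BoundedContinuousFunction E (E [×i]→L[ℝ] F))) := by
  refine isClosed_of_closure_subset fun g hg => ?_
  obtain ⟨l, hl, hlim⟩ : ∃ l : Filter 𝓓_{K}(E, F), l.NeBot ∧ Tendsto (ContinuousLinearMap.pi
      (ContDiffMapSupportedIn.structureMapCLM ℝ ⊤) :
      𝓓_{K}(E, F) →L[ℝ] ∀ i : ℕ, BoundedContinuousFunction E (E [×i]→L[ℝ] F)) l (𝓝 g) :=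
    ⟨comap _ (𝓝 g), comap_neBot_iff_frequently.2 (mem_closure_iff_frequently.1 hg),
      tendsto_comap⟩
  have hi (i : ℕ) : TendstoUniformly (fun (n : 𝓓_{K}(E, F)) x => iteratedFDeriv ℝ i n x) (g i) l := by
    have h := BoundedContinuousFunction.tendsto_iff_tendstoUniformly.1
      ((tendsto_pi_nhds.1 hlim) i)
    convert! h using 2 with n
  have hpt (i : ℕ) (x : E) : Tendsto (fun n : 𝓓_{K}(E, F) => iteratedFDeriv ℝ i n x) l (𝓝 (g i x)) :=
    (hi i).tendsto_at x
  -- The derivatives of every order converge uniformly, so differentiation passes to the limit: the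
  -- components of `g` are the successive derivatives of its zeroth component.
  have hT : HasFTaylorSeriesUpTo ∞ (fun x => (g 0 x).curry0) (fun x i => g i x) := by
    constructor
    · intro x; rfl
    · intro m hm x
      have hunif : TendstoUniformly (fun (n : 𝓓_{K}(E, F)) x => fderiv ℝ (iteratedFDeriv ℝ m n) x)
          (fun x => (g (m + 1) x).curryLeft) l := by
        have h := ((continuousMultilinearCurryLeftEquiv ℝ (fun _ : Fin (m + 1) => E)
          F).toContinuousLinearEquiv.toContinuousLinearMap.uniformContinuous).comp_tendstoUniformly
          (hi (m + 1))
        convert! h using 2 with n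
      refine hasFDerivAt_of_tendstoUniformly hunif (fun n y => ?_) (hpt m) x
      exact ((n.contDiff.differentiable_iteratedFDeriv
        (by exact_mod_cast ENat.natCast_lt_top m)) y).hasFDerivAt
    · intro m _
      exact (g m).continuous
  have hzero : ∀ x ∉ (K : Set E), (g 0 x).curry0 = 0 := by
    intro x hx
    have h1 : g 0 x = 0 := by
      refine tendsto_nhds_unique (hpt 0 x) ?_
      have : (fun n : 𝓓_{K}(E, F) => iteratedFDeriv ℝ 0 n x) = fun _ => 0 := by
        funext n; exact n.iteratedFDeriv_zero_on_compl hx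
      rw [this]; exact tendsto_const_nhds
    rw [h1]; rfl
  refine ⟨⟨fun x => (g 0 x).curry0, hT.contDiff, fun x hx => hzero x hx⟩, ?_⟩
  funext i
  ext1 x
  refine (congrFun (ContDiffMapSupportedIn.structureMapCLM_top_apply ℝ _) x).trans ?_
  exact (hT.eq_iteratedFDeriv (m := i) (by exact_mod_cast le_top) x).symm

instance completeSpace_contDiffMapSupportedIn [CompleteSpace F] (K : Compacts E) :
    CompleteSpace 𝓓_{K}(E, F) :=
  (ContDiffMapSupportedIn.isUniformEmbedding_pi_structureMapCLM ℝ).toIsUniformInducing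
    |>.completeSpace (isClosed_range_structureMaps K).isComplete

instance baireSpace_contDiffMapSupportedIn [CompleteSpace F] (K : Compacts E) :
    BaireSpace 𝓓_{K}(E, F) := by
  -- The uniformity is pulled back from a countable product of normed spaces, so the space is
  -- pseudometrizable; completeness then gives Baire.
  have : IsCountablyGenerated (uniformity 𝓓_{K}(E, F)) := by
    rw [← (ContDiffMapSupportedIn.isUniformEmbedding_pi_structureMapCLM
      (E := E) (F := F) (K := K) (n := ⊤) ℝ).comap_uniformity]
    infer_instance
  let := UniformSpace.pseudoMetricSpace 𝓓_{K}(E, F)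
  infer_instance

end Completeness

/-! ### Local `C^N` bounds and the Banach–Steinhaus theorem. -/

section Equibounded

variable {d : ℕ} {𝕜 : Type*} [RCLike 𝕜]

/-- On the test functions supported in any given compact set, the functionals `T i` are bounded,
uniformly in `i`, by a multiple of some `C^N` norm. -/
def LocallyEquibounded {ι : Type*} (T : ι → TestFn d →ₗ[ℝ] 𝕜) : Prop :=
  ∀ K : Set (Rn d), IsCompact K → ∃ (N : ℕ) (C : ℝ), 0 ≤ C ∧ ∀ φ : TestFn d,
    Function.support φ ⊆ K → ∀ M : ℝ, (∀ k ≤ N, ∀ x, ‖iteratedFDeriv ℝ k φ x‖ ≤ M) →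
      ∀ i, ‖T i φ‖ ≤ C * M

/-- Continuity of a functional on `𝒟(ℝ^d)`, in terms of `C^N` norms. -/
abbrev LocallyBounded (L : TestFn d →ₗ[ℝ] 𝕜) : Prop :=
  LocallyEquibounded fun _ : Unit => L

/-- A continuous seminorm is dominated by finitely many of the defining seminorms; `N` is the
highest order among them. The free bound `M` avoids suprema of derivatives. -/
theorem exists_bound_of_continuous_seminorm (K : Compacts (Rn d))
    (q : Seminorm ℝ 𝓓_{K}(Rn d, ℝ)) (hq : Continuous q) :
    ∃ (N : ℕ) (C : ℝ), 0 ≤ C ∧ ∀ (φ : 𝓓_{K}(Rn d, ℝ)) (M : ℝ),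
      (∀ k ≤ N, ∀ x, ‖iteratedFDeriv ℝ k φ x‖ ≤ M) → q φ ≤ C * M := by
  obtain ⟨s, C, -, hC⟩ := Seminorm.bound_of_continuous
    (ContDiffMapSupportedIn.withSeminorms ℝ (Rn d) ℝ ⊤ K) q hq
  refine ⟨s.sup id, C, C.2, fun φ M hM => ?_⟩
  have hM0 : 0 ≤ M := (norm_nonneg _).trans (hM 0 (Nat.zero_le _) 0)
  refine (hC φ).trans ?_
  rw [smul_apply, NNReal.smul_def, smul_eq_mul]
  refine mul_le_mul_of_nonneg_left (Seminorm.finset_sup_apply_le hM0 fun k hk => ?_) C.2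
  exact (ContDiffMapSupportedIn.seminorm_top_le_iff ℝ hM0 k φ).2 fun x _ =>
    hM k (Finset.le_sup (f := id) hk) x

/-- A test function whose support lies in the compact set `K`, as an element of `𝓓_K`. -/
def toSupportedIn {K : Compacts (Rn d)} (φ : TestFn d) (h : Function.support φ ⊆ K) :
    𝓓_{K}(Rn d, ℝ) :=
  .of_support_subset φ.contDiff h

/-- The inclusion of `𝓓_K` in the space of test functions. -/
def inclusion (K : Compacts (Rn d)) : 𝓓_{K}(Rn d, ℝ) →L[ℝ] TestFn d :=
  TestFunction.ofSupportedInCLM ℝ (Set.subset_univ _)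

theorem locallyBounded_distr (f : Distr d 𝕜) :
    LocallyBounded (f : TestFn d →L[ℝ] 𝕜).toLinearMap := by
  intro K hK
  let K' : Compacts (Rn d) := ⟨K, hK⟩
  obtain ⟨N, C, hC, h⟩ := exists_bound_of_continuous_seminorm K'
    ((normSeminorm ℝ 𝕜).comp ((f : TestFn d →L[ℝ] 𝕜).comp (inclusion K')).toLinearMap)
    (continuous_norm.comp ((f : TestFn d →L[ℝ] 𝕜).comp (inclusion K')).continuous)
  exact ⟨N, C, hC, fun φ hφ M hM _ => h (toSupportedIn φ hφ) M hM⟩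

/-- A locally bounded functional restricts to a continuous functional on `𝓓_K`. -/
theorem LocallyBounded.continuous_restrict {L : TestFn d →ₗ[ℝ] 𝕜} (hL : LocallyBounded L)
    (K : Compacts (Rn d)) :
    Continuous (L.comp (inclusion K).toLinearMap) := by
  obtain ⟨N, C, hC, h⟩ := hL K K.isCompact
  refine WithSeminorms.continuous_normedSpace_rng 𝕜
    (ContDiffMapSupportedIn.withSeminorms ℝ (Rn d) ℝ ⊤ K) _
    ⟨Finset.range (N + 1), ⟨C, hC⟩, fun φ => ?_⟩
  refine h (inclusion K φ) φ.support_subset _ (fun k hk x => ?_) ()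
  refine (ContDiffMapSupportedIn.norm_iteratedFDeriv_apply_le_seminorm_top ℝ).trans ?_
  exact Seminorm.le_finset_sup_apply (p := ContDiffMapSupportedIn.seminorm ℝ (Rn d) ℝ ⊤ K)
    (Finset.mem_range.2 (Nat.lt_succ_of_le hk))

/-- The Banach–Steinhaus theorem for functionals on `𝒟(ℝ^d)`. -/
theorem LocallyEquibounded.of_pointwise {ι : Type*} {T : ι → TestFn d →ₗ[ℝ] 𝕜}
    (hT : ∀ i, LocallyBounded (T i)) (hb : ∀ φ, BddAbove (Set.range fun i => ‖T i φ‖)) :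
    LocallyEquibounded T := by
  intro K hK
  let K' : Compacts (Rn d) := ⟨K, hK⟩
  let p : ι → Seminorm ℝ 𝓓_{K'}(Rn d, ℝ) := fun i =>
    (normSeminorm ℝ 𝕜).comp ((T i).comp (inclusion K').toLinearMap)
  have hbdd : BddAbove (Set.range p) :=
    Seminorm.bddAbove_range_iff.2 fun φ => hb (inclusion K' φ)
  -- This is the Banach–Steinhaus step: a Baire space is barrelled, so a pointwise bounded supremum
  -- of continuous seminorms is continuous.
  have hcont : Continuous (⨆ i, p i) := Seminorm.continuous_iSup p
    (fun i => continuous_norm.comp ((hT i).continuous_restrict K')) hbdd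
  rw [← Seminorm.coe_iSup_eq hbdd] at hcont
  obtain ⟨N, C, hC, h⟩ := exists_bound_of_continuous_seminorm K' (⨆ i, p i) hcont
  refine ⟨N, C, hC, fun φ hφ M hM i => le_trans ?_ (h (toSupportedIn φ hφ) M hM)⟩
  exact le_ciSup hbdd i (toSupportedIn φ hφ)

/-- The pointwise limit of locally equibounded functionals is locally bounded. -/
theorem LocallyEquibounded.locallyBounded_of_tendsto {T : ℕ → TestFn d →ₗ[ℝ] 𝕜}
    (hT : LocallyEquibounded T) {L : TestFn d →ₗ[ℝ] 𝕜}
    (hL : ∀ φ, Tendsto (fun n => T n φ) atTop (𝓝 (L φ))) : LocallyBounded L := by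
  intro K hK
  obtain ⟨N, C, hC, h⟩ := hT K hK
  exact ⟨N, C, hC, fun φ hφ M hM _ =>
    le_of_tendsto (hL φ).norm (Eventually.of_forall fun n => h φ hφ M hM n)⟩

end Equibounded

/-! ### Smooth dependence of integrals on parameters and end points. -/

section ParametricIntegral

theorem hasFDerivAt_parametric_intervalIntegral {E F : Type*}
    [NormedAddCommGroup E] [NormedSpace ℝ E] [ProperSpace E]
    [NormedAddCommGroup F] [NormedSpace ℝ F] {g : E × ℝ → F}
    (hg : ContDiff ℝ 1 g) (a b : ℝ) (x₀ : E) :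
    HasFDerivAt (fun x => ∫ t in a..b, g (x, t))
      (∫ t in a..b, (fderiv ℝ g (x₀, t)).comp (ContinuousLinearMap.inl ℝ E ℝ)) x₀ := by
  have hc : Continuous fun p : E × ℝ =>
      (fderiv ℝ g p).comp (ContinuousLinearMap.inl ℝ E ℝ) :=
    (hg.continuous_fderiv one_ne_zero).clm_comp continuous_const
  obtain ⟨C, hC⟩ := ((isCompact_closedBall x₀ 1).prod
    (isCompact_uIcc (a := a) (b := b))).exists_bound_of_continuousOn hc.continuousOn
  refine intervalIntegral.hasFDerivAt_integral_of_dominated_of_fderiv_le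
    (F := fun x t => g (x, t))
    (F' := fun x t => (fderiv ℝ g (x, t)).comp (ContinuousLinearMap.inl ℝ E ℝ))
    (bound := fun _ => C)
    (ball_mem_nhds x₀ one_pos) (Eventually.of_forall fun x => ?_) ?_ ?_ ?_ ?_ ?_
  · exact (hg.continuous.comp (Continuous.prodMk_right x)).aestronglyMeasurable
  · exact (hg.continuous.comp (Continuous.prodMk_right x₀)).intervalIntegrable _ _
  · exact (hc.comp (Continuous.prodMk_right x₀)).aestronglyMeasurable
  · exact Eventually.of_forall fun t ht x hx =>
      hC (x, t) ⟨ball_subset_closedBall hx, Set.uIoc_subset_uIcc ht⟩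
  · exact intervalIntegrable_const
  · refine Eventually.of_forall fun t _ x _ => ?_
    exact ((hg.differentiable one_ne_zero) (x, t)).hasFDerivAt.comp x
      (hasFDerivAt_prodMk_left x t)

/-- Differentiating under the integral sign replaces `F` by `E →L[ℝ] F`, so the induction must
quantify over `F`; both spaces are in `Type` to keep this in one universe. -/
theorem contDiff_parametric_intervalIntegral_nat (n : ℕ) {E : Type}
    [NormedAddCommGroup E] [NormedSpace ℝ E] [ProperSpace E] (a b : ℝ) :
    ∀ {F : Type} [NormedAddCommGroup F] [NormedSpace ℝ F] {g : E × ℝ → F},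
      ContDiff ℝ ∞ g → ContDiff ℝ n (fun x => ∫ t in a..b, g (x, t)) := by
  induction n with
  | zero =>
    intro F _ _ g hg
    refine contDiff_zero.2 (Differentiable.continuous (𝕜 := ℝ) fun x => ?_)
    exact (hasFDerivAt_parametric_intervalIntegral (hg.of_le (by simp)) a b x).differentiableAt
  | succ n ih =>
    intro F _ _ g hg
    have hd := hasFDerivAt_parametric_intervalIntegral (hg.of_le (m := 1) (by simp)) a b
    refine contDiff_succ_iff_fderiv.2 ⟨fun x => (hd x).differentiableAt,
      fun h => absurd h (WithTop.coe_ne_top (a := (n : ℕ∞))), ?_⟩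
    rw [show fderiv ℝ (fun x => ∫ t in a..b, g (x, t)) = _ from funext fun x => (hd x).fderiv]
    exact ih (g := fun p => (fderiv ℝ g p).comp (ContinuousLinearMap.inl ℝ E ℝ))
      ((hg.fderiv_right (by simp)).clm_comp contDiff_const)

/-- An integral over a compact interval depends smoothly on parameters. -/
theorem contDiff_parametric_intervalIntegral {E F : Type}
    [NormedAddCommGroup E] [NormedSpace ℝ E] [ProperSpace E]
    [NormedAddCommGroup F] [NormedSpace ℝ F] {g : E × ℝ → F}
    (hg : ContDiff ℝ ∞ g) (a b : ℝ) : ContDiff ℝ ∞ (fun x => ∫ t in a..b, g (x, t)) :=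
  contDiff_infty.2 fun n => contDiff_parametric_intervalIntegral_nat n a b hg

/-- An integral over an interval depends smoothly on parameters and on its upper end point. -/
theorem contDiff_primitive {E F : Type}
    [NormedAddCommGroup E] [NormedSpace ℝ E] [ProperSpace E]
    [NormedAddCommGroup F] [NormedSpace ℝ F] {g : ℝ × E → F}
    (hg : ContDiff ℝ ∞ g) (a : ℝ) :
    ContDiff ℝ ∞ (fun p : ℝ × E => ∫ s in a..p.1, g (s, p.2)) := by
  -- An affine change of variable moves the variable end point into the integrand.
  have h : (fun p : ℝ × E => ∫ s in a..p.1, g (s, p.2)) =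
      fun p : ℝ × E => (p.1 - a) • ∫ t in (0 : ℝ)..1, g ((p.1 - a) * t + a, p.2) := by
    funext p
    rw [intervalIntegral.smul_integral_comp_mul_add (f := fun s => g (s, p.2))]
    simp
  rw [h]
  refine (contDiff_fst.sub contDiff_const).smul
    (contDiff_parametric_intervalIntegral (g := fun q : (ℝ × E) × ℝ =>
      g ((q.1.1 - a) * q.2 + a, q.1.2)) (hg.comp ?_) 0 1)
  fun_prop

end ParametricIntegral

/-! ### Functionals applied to smooth families of test functions. -/

section Families

variable {d : ℕ} {𝕜 : Type*} [RCLike 𝕜]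

/-- The partial derivatives in the second variable are the full derivatives of `g` restricted to the
directions `0 × E`, hence jointly continuous. -/
theorem continuous_iteratedFDeriv_family {P E F : Type*}
    [NormedAddCommGroup P] [NormedSpace ℝ P] [NormedAddCommGroup E] [NormedSpace ℝ E]
    [NormedAddCommGroup F] [NormedSpace ℝ F] {g : P × E → F} (hg : ContDiff ℝ ∞ g) (k : ℕ) :
    Continuous fun p : P × E => iteratedFDeriv ℝ k (fun x => g (p.1, x)) p.2 := by
  have h (p : P × E) : iteratedFDeriv ℝ k (fun x => g (p.1, x)) p.2 =
      (iteratedFDeriv ℝ k g p).compContinuousLinearMap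
        fun _ => ContinuousLinearMap.inr ℝ P E := by
    have hs : ContDiff ℝ ∞ fun q : P × E => g ((p.1, 0) + q) :=
      hg.comp (contDiff_const.add contDiff_id)
    have h1 := (ContinuousLinearMap.inr ℝ P E).iteratedFDeriv_comp_right hs p.2
      (i := k) (by exact_mod_cast le_top)
    rw [iteratedFDeriv_comp_add_left] at h1
    simpa [Function.comp_def] using h1
  simp_rw [h]
  exact (ContinuousMultilinearMap.compContinuousLinearMapL (F := F)
    fun _ : Fin k => ContinuousLinearMap.inr ℝ P E).continuous.comp
      (hg.continuous_iteratedFDeriv (by exact_mod_cast le_top))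

/-- Functionals that are locally equibounded are equicontinuous along smooth families of test
functions supported in a fixed compact set. -/
theorem LocallyEquibounded.eventually_norm_sub_le {ι : Type*} {T : ι → TestFn d →ₗ[ℝ] 𝕜}
    (hT : LocallyEquibounded T) {u : ℝ → TestFn d}
    (hu : ContDiff ℝ ∞ fun p : ℝ × Rn d => u p.1 p.2) {K : Set (Rn d)} (hK : IsCompact K)
    (huK : ∀ s, Function.support (u s) ⊆ K) (s₀ : ℝ) {ε : ℝ} (hε : 0 < ε) :
    ∀ᶠ s in 𝓝 s₀, ∀ i, ‖T i (u s) - T i (u s₀)‖ ≤ ε := by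
  obtain ⟨N, C, hC, h⟩ := hT K hK
  -- Dividing by `C + 1` allows `C = 0`, and `C * (ε / (C + 1)) ≤ ε`.
  have hδ : 0 < ε / (C + 1) := by positivity
  have hk (k : ℕ) : ∀ᶠ s in 𝓝 s₀, ∀ x ∈ K,
      ‖iteratedFDeriv ℝ k (u s) x - iteratedFDeriv ℝ k (u s₀) x‖ ≤ ε / (C + 1) := by
    -- The difference is jointly continuous and vanishes on `{s₀} × K`; compactness of `K` makes the
    -- neighbourhood of `s₀` uniform in `x`.
    refine hK.eventually_forall_of_forall_eventually
      (P := fun s x => ‖iteratedFDeriv ℝ k (u s) x - iteratedFDeriv ℝ k (u s₀) x‖ ≤ ε / (C + 1))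
      fun x _ => ?_
    have hc := continuous_iteratedFDeriv_family hu k
    have hc' : Continuous fun p : ℝ × Rn d =>
        ‖iteratedFDeriv ℝ k (u p.1) p.2 - iteratedFDeriv ℝ k (u s₀) p.2‖ :=
      (hc.sub (hc.comp (continuous_const.prodMk continuous_snd :
        Continuous fun p : ℝ × Rn d => (s₀, p.2)))).norm
    have := hc'.tendsto (s₀, x)
    simp only [sub_self, norm_zero] at this
    filter_upwards [this.eventually (gt_mem_nhds hδ)] with p hp using hp.le
  have hall : ∀ᶠ s in 𝓝 s₀, ∀ k ∈ Finset.range (N + 1), ∀ x ∈ K,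
      ‖iteratedFDeriv ℝ k (u s) x - iteratedFDeriv ℝ k (u s₀) x‖ ≤ ε / (C + 1) :=
    (Finset.eventually_all _).2 fun k _ => hk k
  filter_upwards [hall] with s hs i
  have hsupp : Function.support (u s - u s₀ : TestFn d) ⊆ K := fun x hx => by
    by_contra hxK
    refine hx ?_
    rw [sub_apply, Function.notMem_support.1 fun h => hxK (huK s h),
      Function.notMem_support.1 fun h => hxK (huK s₀ h), sub_zero]
  rw [← map_sub]
  refine (h _ hsupp (ε / (C + 1)) (fun k hkN x => ?_) i).trans ?_
  · by_cases hx : x ∈ K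
    · have := hs k (Finset.mem_range.2 (Nat.lt_succ_of_le hkN)) x hx
      rwa [← iteratedFDeriv_sub_apply
        ((u s).contDiff.contDiffAt.of_le (by exact_mod_cast le_top))
        ((u s₀).contDiff.contDiffAt.of_le (by exact_mod_cast le_top))] at this
    · have : iteratedFDeriv ℝ k (u s - u s₀ : TestFn d) x = 0 := by
        by_contra hne
        exact hx (closure_minimal hsupp hK.isClosed (support_iteratedFDeriv_subset k hne))
      rw [this, norm_zero]
      exact hδ.le
  · rw [mul_div_assoc', div_le_iff₀ (by positivity)]
    nlinarith

theorem LocallyBounded.continuous_family {L : TestFn d →ₗ[ℝ] 𝕜} (hL : LocallyBounded L)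
    {u : ℝ → TestFn d} (hu : ContDiff ℝ ∞ fun p : ℝ × Rn d => u p.1 p.2)
    {K : Set (Rn d)} (hK : IsCompact K) (huK : ∀ s, Function.support (u s) ⊆ K) :
    Continuous fun s => L (u s) := by
  refine continuous_iff_continuousAt.2 fun s₀ => Metric.tendsto_nhds.2 fun ε hε => ?_
  filter_upwards [hL.eventually_norm_sub_le hu hK huK s₀ (half_pos hε)] with s hs
  rw [dist_eq_norm]
  exact (hs ()).trans_lt (half_lt_self hε)

/-- A smooth function whose support lies in a compact set, as a test function. -/
def mkTest (g : Rn d → ℝ) (hg : ContDiff ℝ ∞ g) {K : Set (Rn d)} (hK : IsCompact K)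
    (h : Function.support g ⊆ K) : TestFn d :=
  ⟨g, hg, HasCompactSupport.of_support_subset_isCompact hK h, Set.subset_univ _⟩

/-- Differentiation of a functional along a smooth family of test functions. -/
theorem LocallyBounded.hasDerivAt_family {L : TestFn d →ₗ[ℝ] 𝕜} (hL : LocallyBounded L)
    {u : ℝ → TestFn d} (hu : ContDiff ℝ ∞ fun p : ℝ × Rn d => u p.1 p.2)
    {K : Set (Rn d)} (hK : IsCompact K) (huK : ∀ s, Function.support (u s) ⊆ K)
    {s₀ : ℝ} {v : TestFn d} (hv : ∀ x, HasDerivAt (fun s => u s x) (v x) s₀) :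
    HasDerivAt (fun s => L (u s)) (L v) s₀ := by
  set g : ℝ × Rn d → ℝ := fun p => u p.1 p.2 with hgdef
  have hw : ContDiff ℝ ∞ fun p => fderiv ℝ g p (1, 0) :=
    (hu.fderiv_right (by simp)).clm_apply contDiff_const
  have hderiv (s : ℝ) (x : Rn d) : HasDerivAt (fun s => u s x) (fderiv ℝ g (s, x) (1, 0)) s :=
    ((hu.differentiable (by simp)) (s, x)).hasFDerivAt.comp_hasDerivAt (f := fun s => (s, x)) s
      ((hasDerivAt_id s).prodMk (hasDerivAt_const s x))
  -- Hadamard's lemma: `u s - u s₀ = (s - s₀) q s` with `q` again a smooth family and `q s₀ = v`.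
  -- The slope of `L (u s)` is then `L (q s)`, and continuity along `q` suffices.
  let Q : ℝ × Rn d → ℝ := fun p => ∫ t in (0 : ℝ)..1, fderiv ℝ g (s₀ + t * (p.1 - s₀), p.2) (1, 0)
  have hQ : ContDiff ℝ ∞ Q := by
    refine contDiff_parametric_intervalIntegral (g := fun q : (ℝ × Rn d) × ℝ =>
      fderiv ℝ g (s₀ + q.2 * (q.1.1 - s₀), q.1.2) (1, 0)) (hw.comp ?_) 0 1
    fun_prop
  have hw0 (s : ℝ) (x : Rn d) (hx : x ∉ K) : fderiv ℝ g (s, x) (1, 0) = 0 := by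
    refine (hderiv s x).unique ?_
    have : (fun s => u s x) = fun _ => 0 :=
      funext fun s => Function.notMem_support.1 fun h => hx (huK s h)
    rw [this]
    exact hasDerivAt_const s 0
  have hQK (s : ℝ) : Function.support (fun x => Q (s, x)) ⊆ K := by
    intro x hx
    by_contra hxK
    exact hx (by simp [Q, hw0 _ x hxK])
  let q : ℝ → TestFn d := fun s => mkTest (fun x => Q (s, x))
    (hQ.comp (contDiff_prodMk_right s)) hK (hQK s)
  have hqL : Continuous fun s => L (q s) := hL.continuous_family hQ hK hQK
  have hq₀ : q s₀ = v := by
    ext x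
    change Q (s₀, x) = v x
    simp only [Q, sub_self, mul_zero, add_zero, intervalIntegral.integral_const, sub_zero, one_smul]
    exact (hderiv s₀ x).unique (hv x)
  have hsub (s : ℝ) : u s - u s₀ = (s - s₀) • q s := by
    ext x
    change u s x - u s₀ x = (s - s₀) • Q (s, x)
    have h1 := intervalIntegral.smul_integral_comp_mul_add
      (a := 0) (b := 1) (fun r => fderiv ℝ g (r, x) (1, 0)) (s - s₀) s₀
    have h2 := intervalIntegral.integral_eq_sub_of_hasDerivAt (a := s₀) (b := s)
      (fun r _ => hderiv r x)
      ((hw.continuous.comp (continuous_id.prodMk continuous_const)).intervalIntegrable _ _)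
    rw [← h2]
    simp only [mul_zero, zero_add, mul_one, sub_add_cancel] at h1
    rw [← h1]
    simp only [Q]
    congr 2
    funext t
    rw [mul_comm, add_comm]
  rw [hasDerivAt_iff_tendsto_slope]
  rw [← hq₀]
  refine ((hqL.tendsto s₀).mono_left nhdsWithin_le_nhds).congr' ?_
  filter_upwards [self_mem_nhdsWithin] with s hs
  rw [slope_def_module, ← map_sub, hsub, map_smul, smul_smul,
    inv_mul_cancel₀ (sub_ne_zero.2 hs), one_smul]

/-- A functional commutes with the integral of a smooth family of test functions. -/
theorem LocallyBounded.map_integral_family {L : TestFn d →ₗ[ℝ] 𝕜} (hL : LocallyBounded L)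
    {u : ℝ → TestFn d} (hu : ContDiff ℝ ∞ fun p : ℝ × Rn d => u p.1 p.2)
    {K : Set (Rn d)} (hK : IsCompact K) (huK : ∀ s, Function.support (u s) ⊆ K)
    (a b : ℝ) {I : TestFn d} (hI : ∀ x, I x = ∫ s in a..b, u s x) :
    L I = ∫ s in a..b, L (u s) := by
  -- The primitive of the family, taken pointwise, is a smooth family with derivative `u`; applying
  -- `L` and the fundamental theorem of calculus exchanges `L` with the integral.
  have hU := contDiff_primitive hu a
  have hUK (t : ℝ) : Function.support (fun x => ∫ s in a..t, u s x) ⊆ K := by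
    intro x hx
    by_contra hxK
    have (s : ℝ) : u s x = 0 := Function.notMem_support.1 fun h => hxK (huK s h)
    exact hx (by simp [this])
  let U : ℝ → TestFn d := fun t => mkTest (fun x => ∫ s in a..t, u s x)
    (hU.comp (contDiff_prodMk_right t)) hK (hUK t)
  have hder (t : ℝ) : HasDerivAt (fun t => L (U t)) (L (u t)) t := by
    refine hL.hasDerivAt_family hU hK hUK fun x => ?_
    have hc : Continuous fun s => u s x := hu.continuous.comp (continuous_id.prodMk continuous_const)
    exact intervalIntegral.integral_hasDerivAt_right (hc.intervalIntegrable _ _)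
      (hc.stronglyMeasurableAtFilter _ _) hc.continuousAt
  rw [intervalIntegral.integral_eq_sub_of_hasDerivAt (fun t _ => hder t)
    ((hL.continuous_family hu hK huK).intervalIntegrable _ _)]
  have hb : U b = I := by ext x; exact (hI x).symm
  have ha : U a = 0 := by ext x; exact intervalIntegral.integral_same
  rw [hb, ha, map_zero, sub_zero]

end Families

/-! ### Dilations and the functionals of the delta sequences. -/

section Rescaling

variable {d : ℕ} {𝕜 : Type*} [RCLike 𝕜]

theorem dilate_apply {a : ℝ} (ha : a ≠ 0) (φ : TestFn d) (x : Rn d) :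
    dilate a φ x = φ (a • x) :=
  if_neg ha

theorem dilate_zero_apply (φ : TestFn d) (x : Rn d) : dilate 0 φ x = 0 :=
  if_pos rfl

theorem dilate_dilate {a b : ℝ} (ha : a ≠ 0) (hb : b ≠ 0) (φ : TestFn d) :
    dilate a (dilate b φ) = dilate (b * a) φ := by
  ext x
  rw [dilate_apply ha, dilate_apply hb, dilate_apply (mul_ne_zero hb ha), mul_smul]

theorem dilate_one (φ : TestFn d) : dilate 1 φ = φ := by
  ext x
  rw [dilate_apply one_ne_zero, one_smul]

/-- The linear map `φ ↦ φ (a (x - x₀))`, for `a ≠ 0`. -/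
def rescaleTest (x₀ : Rn d) (a : ℝ) : TestFn d →ₗ[ℝ] TestFn d where
  toFun φ := translate x₀ (dilate a φ)
  map_add' φ ψ := by
    ext x
    change (dilate a (φ + ψ)) (x - x₀) = (dilate a φ) (x - x₀) + (dilate a ψ) (x - x₀)
    rcases eq_or_ne a 0 with rfl | ha
    · simp only [dilate_zero_apply, add_zero]
    · simp only [dilate_apply ha, add_apply]
  map_smul' c φ := by
    ext x
    change (dilate a (c • φ)) (x - x₀) = c • (dilate a φ) (x - x₀)
    rcases eq_or_ne a 0 with rfl | ha
    · simp only [dilate_zero_apply, smul_zero]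
    · simp only [dilate_apply ha, smul_apply]

theorem LocallyBounded.comp_rescaleTest {L : TestFn d →ₗ[ℝ] 𝕜} (hL : LocallyBounded L)
    (x₀ : Rn d) (a : ℝ) : LocallyBounded (L.comp (rescaleTest x₀ a)) := by
  intro K hK
  -- The value `a = 0` occurs in the term `n = 0` of the delta sequence, where the dilation is zero
  -- by convention.
  rcases eq_or_ne a 0 with rfl | ha
  · refine ⟨0, 0, le_rfl, fun φ _ M _ _ => ?_⟩
    have : rescaleTest x₀ 0 φ = 0 := by
      ext x
      exact dilate_zero_apply φ (x - x₀)
    rw [LinearMap.comp_apply, this, map_zero, norm_zero, zero_mul]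
  obtain ⟨N, C, hC, h⟩ := hL ((fun x => a⁻¹ • x + x₀) '' K) (hK.image (by fun_prop))
  -- By the chain rule the `k`-th derivative picks up `|a|^k`, which is at most `max 1 |a| ^ N` for
  -- `k ≤ N`.
  refine ⟨N, C * (max 1 |a|) ^ N, by positivity, fun φ hφ M hM _ => ?_⟩
  have hM0 : 0 ≤ M := (norm_nonneg _).trans (hM 0 (Nat.zero_le _) 0)
  have happ : (rescaleTest x₀ a φ : Rn d → ℝ) = fun x => φ (a • (x - x₀)) :=
    funext fun x => dilate_apply ha φ (x - x₀)
  rw [mul_assoc]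
  refine h (rescaleTest x₀ a φ) (fun x hx => ?_) _ (fun k hk x => ?_) ()
  · rw [Function.mem_support, happ] at hx
    exact ⟨a • (x - x₀), hφ hx, by simp [smul_smul, inv_mul_cancel₀ ha]⟩
  · rw [happ, iteratedFDeriv_comp_sub (f := fun x => φ (a • x)),
      iteratedFDeriv_comp_const_smul a (φ.contDiff.of_le (by exact_mod_cast le_top)), norm_smul,
      norm_pow, Real.norm_eq_abs]
    refine mul_le_mul ?_ (hM k hk _) (norm_nonneg _) (by positivity)
    exact (pow_le_pow_left₀ (abs_nonneg a) (le_max_right _ _) k).trans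
      (pow_le_pow_right₀ (le_max_left _ _) hk)

/-- The functionals `φ ↦ ⟨f(x₀ + x), n^d φ(n x)⟩`. -/
def deltaSeqFunctional (f : Distr d 𝕜) (x₀ : Rn d) (n : ℕ) : TestFn d →ₗ[ℝ] 𝕜 :=
  ((n : ℝ) ^ d) • (f : TestFn d →L[ℝ] 𝕜).toLinearMap.comp (rescaleTest x₀ n)

theorem deltaSeqFunctional_apply (f : Distr d 𝕜) (x₀ : Rn d) (n : ℕ) (φ : TestFn d) :
    deltaSeqFunctional f x₀ n φ = pairTranslate f x₀ (stdDeltaSeq φ n) :=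
  ((f : TestFn d →L[ℝ] 𝕜).map_smul ((n : ℝ) ^ d) (translate x₀ (dilate (n : ℝ) φ))).symm

theorem pairRescale_eq (f : Distr d 𝕜) (x₀ : Rn d) (ε : ℝ) (φ : TestFn d) :
    pairRescale f x₀ ε φ = (ε ^ d)⁻¹ • f (translate x₀ (dilate ε⁻¹ φ)) :=
  (f : TestFn d →L[ℝ] 𝕜).map_smul _ _

theorem pairRescale_inv_natCast (f : Distr d 𝕜) (x₀ : Rn d) (n : ℕ) (φ : TestFn d) :
    pairRescale f x₀ (n : ℝ)⁻¹ φ = deltaSeqFunctional f x₀ n φ := by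
  rw [pairRescale_eq, inv_pow, inv_inv, inv_inv]
  rfl

/-- A dilation of the test function can be traded for a change of scale. This serves both to reach
real `ε` from integers and to prove homogeneity of the limit. -/
theorem pairRescale_dilate (f : Distr d 𝕜) (x₀ : Rn d) {ε t : ℝ} (hε : ε ≠ 0) (ht : t ≠ 0)
    (φ : TestFn d) :
    pairRescale f x₀ ε (dilate t φ) = (t ^ d)⁻¹ • pairRescale f x₀ (ε / t) φ := by
  rw [pairRescale_eq, pairRescale_eq, dilate_dilate (inv_ne_zero hε) ht, smul_smul, inv_div,
    div_pow, inv_div, ← div_eq_mul_inv, div_eq_mul_inv t ε]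
  congr 1
  field_simp

theorem LocallyBounded.smul {L : TestFn d →ₗ[ℝ] 𝕜} (hL : LocallyBounded L) (c : ℝ) :
    LocallyBounded (c • L) := by
  intro K hK
  obtain ⟨N, C, hC, h⟩ := hL K hK
  refine ⟨N, |c| * C, by positivity, fun φ hφ M hM i => ?_⟩
  rw [LinearMap.smul_apply, norm_smul, mul_assoc, Real.norm_eq_abs]
  exact mul_le_mul_of_nonneg_left (h φ hφ M hM i) (abs_nonneg c)

theorem locallyBounded_deltaSeqFunctional (f : Distr d 𝕜) (x₀ : Rn d) (n : ℕ) :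
    LocallyBounded (deltaSeqFunctional f x₀ n) :=
  ((locallyBounded_distr f).comp_rescaleTest x₀ n).smul _

end Rescaling

/-! ### Cutoff functions and families of dilations. -/

section Cutoff

variable {d : ℕ}

theorem exists_cutoff (R : ℝ) : ∃ χ : TestFn d, (∀ x, 0 ≤ χ x) ∧ (∀ x, ‖x‖ ≤ R → χ x = 1) ∧
    0 < ∫ x, χ x := by
  let b : ContDiffBump (0 : Rn d) := ⟨max R 1, max R 1 + 1, by positivity, by linarith⟩
  refine ⟨⟨b, b.contDiff, b.hasCompactSupport, Set.subset_univ _⟩, fun x => b.nonneg,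
    fun x hx => b.one_of_mem_closedBall ?_, b.integral_pos⟩
  rw [mem_closedBall_zero_iff]
  exact hx.trans (le_max_left _ _)

theorem exists_radius (φ : TestFn d) : ∃ R > 0, ∀ x, R < ‖x‖ → φ x = 0 := by
  obtain ⟨R, hR, h⟩ := φ.hasCompactSupport.isCompact.isBounded.exists_pos_norm_le
  refine ⟨R, hR, fun x hx => image_eq_zero_of_notMem_tsupport fun hx' => ?_⟩
  exact (h x hx').not_gt hx

/-- The product of a test function and a smooth function. -/
def mulTest (χ : TestFn d) (g : Rn d → ℝ) (hg : ContDiff ℝ ∞ g) : TestFn d :=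
  mkTest (fun x => χ x * g x) (χ.contDiff.mul hg) χ.hasCompactSupport.isCompact
    fun _ hx => subset_tsupport _ (left_ne_zero_of_mul hx)

theorem support_mulTest (χ : TestFn d) (g : Rn d → ℝ) (hg : ContDiff ℝ ∞ g) :
    Function.support (mulTest χ g hg) ⊆ tsupport χ :=
  fun _ hx => subset_tsupport _ (left_ne_zero_of_mul hx)

/-- For `t` near `1`, the dilations of a test function form a smooth family with supports in a
fixed compact set. -/
theorem exists_dilate_family (φ : TestFn d) : ∃ u : ℝ → TestFn d, ∃ K : Set (Rn d),
    ContDiff ℝ ∞ (fun p : ℝ × Rn d => u p.1 p.2) ∧ IsCompact K ∧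
    (∀ t, Function.support (u t) ⊆ K) ∧ ∀ t, 1 / 2 ≤ t → u t = dilate t φ := by
  obtain ⟨R, hR, hφ⟩ := exists_radius φ
  obtain ⟨χ, -, hχ, -⟩ := exists_cutoff (d := d) (2 * R)
  -- For `t ≥ 1/2` the function `φ(t ·)` vanishes outside the ball of radius `2R`, where `χ = 1`.
  -- The factor `χ` changes nothing there and keeps the supports in one compact set for all other
  -- `t`.
  refine ⟨fun t => mulTest χ (fun x => φ (t • x)) (φ.contDiff.comp (contDiff_const_smul t)),
    tsupport χ, ?_, χ.hasCompactSupport.isCompact, fun t => support_mulTest _ _ _,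
    fun t ht => ?_⟩
  · exact (χ.contDiff.comp contDiff_snd).mul
      (φ.contDiff.comp (contDiff_fst.smul contDiff_snd))
  · ext x
    rw [dilate_apply (by linarith)]
    change χ x * φ (t • x) = φ (t • x)
    by_cases hx : ‖x‖ ≤ 2 * R
    · rw [hχ x hx, one_mul]
    · rw [hφ (t • x), mul_zero]
      rw [norm_smul, Real.norm_of_nonneg (by linarith)]
      nlinarith

end Cutoff

/-! ### From positive normalized test functions to a homogeneous limit. -/

section Limit

variable {d : ℕ} {𝕜 : Type*} [RCLike 𝕜] {f : Distr d 𝕜} {x₀ : Rn d}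

theorem integrable_testFn (φ : TestFn d) : Integrable φ :=
  φ.continuous.integrable_of_hasCompactSupport φ.hasCompactSupport

/-- If the limit along the standard delta sequences exists for the positive normalized test
functions, it exists for all test functions. -/
theorem exists_limit_of_posNormalized
    (h : ∀ φ : TestFn d, IsPosNormalized φ → ∃ γ : 𝕜,
      Tendsto (fun n : ℕ => pairTranslate f x₀ (stdDeltaSeq φ n)) atTop (𝓝 γ)) (φ : TestFn d) :
    ∃ γ : 𝕜, Tendsto (fun n : ℕ => deltaSeqFunctional f x₀ n φ) atTop (𝓝 γ) := by
  have hpos (ψ : TestFn d) (h0 : ∀ x, 0 ≤ ψ x) (h1 : 0 < ∫ x, ψ x) :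
      ∃ γ : 𝕜, Tendsto (fun n : ℕ => deltaSeqFunctional f x₀ n ψ) atTop (𝓝 γ) := by
    obtain ⟨γ, hγ⟩ := h ((∫ x, ψ x)⁻¹ • ψ)
      ⟨fun x => mul_nonneg (inv_nonneg.2 h1.le) (h0 x), by
        simp only [smul_apply, smul_eq_mul]
        rw [integral_const_mul, inv_mul_cancel₀ h1.ne']⟩
    refine ⟨(∫ x, ψ x) • γ, (hγ.const_smul (∫ x, ψ x)).congr fun n => ?_⟩
    rw [← deltaSeqFunctional_apply, map_smul, smul_smul, mul_inv_cancel₀ h1.ne', one_smul]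
  obtain ⟨R, -, hR⟩ := exists_radius φ
  obtain ⟨χ, hχ0, hχ1, hχ⟩ := exists_cutoff (d := d) R
  obtain ⟨C, hC⟩ := φ.continuous.bounded_above_of_compact_support φ.hasCompactSupport
  have hC0 : 0 ≤ C := (norm_nonneg _).trans (hC 0)
  -- `φ = (C + 1) χ - ((C + 1) χ - φ)`. With `C + 1` in place of `C`, both terms dominate `χ`, so
  -- their integrals are strictly positive and they can be normalized.
  have h₁ (x : Rn d) : χ x ≤ ((C + 1) • χ) x := by
    rw [smul_apply, smul_eq_mul]
    nlinarith [hχ0 x]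
  have h₂ (x : Rn d) : χ x ≤ ((C + 1) • χ - φ) x := by
    rw [sub_apply, smul_apply, smul_eq_mul]
    by_cases hx : ‖x‖ ≤ R
    · rw [hχ1 x hx]
      linarith [(le_abs_self _).trans (hC x)]
    · rw [hR x (not_le.1 hx)]
      nlinarith [hχ0 x]
  obtain ⟨γ₁, hγ₁⟩ := hpos ((C + 1) • χ) (fun x => (hχ0 x).trans (h₁ x))
    (hχ.trans_le (integral_mono (integrable_testFn _) (integrable_testFn _) h₁))
  obtain ⟨γ₂, hγ₂⟩ := hpos ((C + 1) • χ - φ) (fun x => (hχ0 x).trans (h₂ x))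
    (hχ.trans_le (integral_mono (integrable_testFn _) (integrable_testFn _) h₂))
  refine ⟨γ₁ - γ₂, (hγ₁.sub hγ₂).congr fun n => ?_⟩
  rw [← map_sub, sub_sub_cancel]

/-- Convergence along the standard delta sequences implies convergence for `ε → 0⁺`. -/
theorem tendsto_pairRescale {L : TestFn d →ₗ[ℝ] 𝕜}
    (hL : ∀ φ, Tendsto (fun n : ℕ => deltaSeqFunctional f x₀ n φ) atTop (𝓝 (L φ)))
    (hT : LocallyEquibounded fun n : ℕ => deltaSeqFunctional f x₀ n) (φ : TestFn d) :
    Tendsto (fun ε => pairRescale f x₀ ε φ) (𝓝[>] 0) (𝓝 (L φ)) := by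
  obtain ⟨u, K, hu, hK, huK, hud⟩ := exists_dilate_family φ
  let n : ℝ → ℕ := fun ε => ⌊ε⁻¹⌋₊
  let t : ℝ → ℝ := fun ε => (n ε / ε⁻¹)⁻¹
  have hn : Tendsto n (𝓝[>] 0) atTop := tendsto_nat_floor_atTop.comp tendsto_inv_nhdsGT_zero
  have ht : Tendsto t (𝓝[>] 0) (𝓝 1) := by
    have := ((tendsto_nat_floor_div_atTop (R := ℝ)).comp tendsto_inv_nhdsGT_zero).inv₀ one_ne_zero
    rwa [inv_one] at this
  have hu1 : u 1 = φ := by rw [hud 1 (by norm_num), dilate_one]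
  -- The index `n ε` and the test function `u (t ε)` move together; the bound on the difference is
  -- uniform in the index.
  have hdiff : Tendsto (fun ε => deltaSeqFunctional f x₀ (n ε) (u (t ε)) -
      deltaSeqFunctional f x₀ (n ε) φ) (𝓝[>] 0) (𝓝 0) := by
    refine Metric.tendsto_nhds.2 fun δ hδ => ?_
    filter_upwards [ht.eventually (hT.eventually_norm_sub_le hu hK huK 1 (half_pos hδ))] with ε hε
    rw [dist_zero_right]
    rw [hu1] at hε
    exact (hε (n ε)).trans_lt (half_lt_self hδ)
  have hlim := (ht.pow d).smul (hdiff.add ((hL φ).comp hn))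
  rw [one_pow, one_smul, zero_add] at hlim
  refine hlim.congr' ?_
  filter_upwards [self_mem_nhdsWithin, ht.eventually (lt_mem_nhds (by norm_num : (1 / 2 : ℝ) < 1)),
    hn.eventually (eventually_gt_atTop 0)] with ε hε htε hnε
  have hε0 : ε ≠ 0 := ne_of_gt hε
  have hn0 : (n ε : ℝ) ≠ 0 := Nat.cast_ne_zero.2 hnε.ne'
  have ht0 : t ε ≠ 0 := by linarith
  simp only [Function.comp_apply, sub_add_cancel]
  rw [hud _ htε.le, ← pairRescale_inv_natCast, pairRescale_dilate f x₀ (inv_ne_zero hn0) ht0,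
    smul_smul, mul_inv_cancel₀ (pow_ne_zero d ht0), one_smul]
  congr 1
  simp only [t]
  field_simp

/-- The limit functional is homogeneous of degree `0`. -/
theorem limit_dilate {L : TestFn d →ₗ[ℝ] 𝕜}
    (hL : ∀ φ, Tendsto (fun ε => pairRescale f x₀ ε φ) (𝓝[>] 0) (𝓝 (L φ)))
    {t : ℝ} (ht : 0 < t) (φ : TestFn d) : L (dilate t φ) = (t ^ d)⁻¹ • L φ := by
  refine tendsto_nhds_unique (hL (dilate t φ)) ?_
  -- Rescaling `ε` by an arbitrary `t > 0` leaves the limit unchanged; this needs the limit over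
  -- real `ε`, not only over `1/n`.
  have hdiv : Tendsto (fun ε : ℝ => ε / t) (𝓝[>] 0) (𝓝[>] 0) := by
    refine tendsto_nhdsWithin_iff.2 ⟨?_, ?_⟩
    · have : Tendsto (fun ε : ℝ => ε / t) (𝓝 0) (𝓝 (0 / t)) := tendsto_id.div_const t
      rw [zero_div] at this
      exact this.mono_left nhdsWithin_le_nhds
    · filter_upwards [self_mem_nhdsWithin] with ε hε using div_pos hε ht
  refine (((hL φ).comp hdiv).const_smul ((t ^ d)⁻¹)).congr' ?_
  filter_upwards [self_mem_nhdsWithin] with ε hε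
  exact (pairRescale_dilate f x₀ (ne_of_gt hε) ht.ne' φ).symm

end Limit

/-! ### Homogeneous extensions from the sphere and their derivative bounds. -/

section HomogeneousExtension

variable {d : ℕ}

theorem homExt_of_ne {ψ : Sph d → ℝ} {x : Rn d} (hx : x ≠ 0) (h : ‖x‖⁻¹ • x ∈ sphere (0 : Rn d) 1) :
    homExt ψ x = ψ ⟨‖x‖⁻¹ • x, h⟩ :=
  dif_pos hx

theorem homExt_smul (ψ : Sph d → ℝ) {c : ℝ} (hc : 0 < c) (x : Rn d) :
    homExt ψ (c • x) = homExt ψ x := by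
  by_cases hx : x = 0
  · rw [hx, smul_zero]
  · have hcx : c • x ≠ 0 := smul_ne_zero hc.ne' hx
    have : ‖c • x‖⁻¹ • c • x = ‖x‖⁻¹ • x := by
      rw [norm_smul, Real.norm_of_nonneg hc.le, smul_smul, mul_inv, mul_comm c⁻¹, mul_assoc,
        inv_mul_cancel₀ hc.ne', mul_one]
    simp only [homExt, dif_pos hx, dif_pos hcx, this]

/-- The homogeneous extension of a smooth function on the sphere is smooth away from the origin:
locally, the radial projection agrees with a smooth map from the whole space to the sphere. -/
theorem contDiffAt_homExt [NeZero d] (ψ : SphTestFn d) {x₀ : Rn d} (hx₀ : x₀ ≠ 0) :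
    ContDiffAt ℝ ∞ (homExt ψ) x₀ := by
  have hr : 0 < ‖x₀‖ := norm_pos_iff.2 hx₀
  let b : ContDiffBump x₀ := ⟨‖x₀‖ / 4, ‖x₀‖ / 2, by positivity, by linarith⟩
  -- `m` is the identity near `x₀` and stays within `‖x₀‖ / 2` of `x₀`, so it never vanishes and `m
  -- / ‖m‖` is a globally smooth map to the sphere.
  let m : Rn d → Rn d := fun x => x₀ + b x • (x - x₀)
  have hm : ContDiff ℝ ∞ m :=
    contDiff_const.add (b.contDiff.smul (contDiff_id.sub contDiff_const))
  have hm0 (x : Rn d) : m x ≠ 0 := by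
    have h1 : ‖b x • (x - x₀)‖ ≤ ‖x₀‖ / 2 := by
      rw [norm_smul, Real.norm_of_nonneg b.nonneg]
      by_cases hx : dist x x₀ < ‖x₀‖ / 2
      · rw [← dist_eq_norm]
        exact (mul_le_of_le_one_left dist_nonneg b.le_one).trans hx.le
      · rw [b.zero_of_le_dist (not_lt.1 hx), zero_mul]
        positivity
    intro h
    have h2 : b x • (x - x₀) = -x₀ := by
      rw [eq_neg_iff_add_eq_zero, add_comm]; exact h
    rw [h2, norm_neg] at h1
    linarith
  have hG : ContDiff ℝ ∞ fun x => ‖m x‖⁻¹ • m x :=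
    ((hm.norm ℝ hm0).inv fun x => norm_ne_zero_iff.2 (hm0 x)).smul hm
  have hGs (x : Rn d) : ‖m x‖⁻¹ • m x ∈ sphere (0 : Rn d) 1 := by
    rw [mem_sphere_zero_iff_norm, norm_smul, norm_inv, norm_norm,
      inv_mul_cancel₀ (norm_ne_zero_iff.2 (hm0 x))]
  have hψ : ContDiff ℝ ∞ fun x => ψ (Set.codRestrict _ _ hGs x) :=
    (ψ.contMDiff.comp (hG.contMDiff.codRestrict_sphere hGs)).contDiff
  refine hψ.contDiffAt.congr_of_eventuallyEq ?_
  filter_upwards [closedBall_mem_nhds x₀ (by positivity : 0 < ‖x₀‖ / 4),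
    isOpen_ne.mem_nhds hx₀] with x hx hx0
  have hmx : m x = x := by
    simp [m, b.one_of_mem_closedBall hx]
  have hs : ‖x‖⁻¹ • x ∈ sphere (0 : Rn d) 1 := by rw [← hmx]; exact hGs x
  rw [homExt_of_ne hx0 hs]
  congr 1
  ext1
  simp only [Set.val_codRestrict_apply, hmx]

theorem continuousAt_iteratedFDeriv_homExt [NeZero d] (ψ : SphTestFn d) (k : ℕ) {x : Rn d}
    (hx : x ≠ 0) : ContinuousAt (iteratedFDeriv ℝ k (homExt ψ)) x := by
  have h := ContDiffAt.iteratedFDeriv_right (m := 0) (i := k) (contDiffAt_homExt ψ hx)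
    (by rw [zero_add]; exact_mod_cast le_top)
  exact h.continuousAt

/-- The `k`-th derivative of a function homogeneous of degree 0 is homogeneous of degree `-k`, so
moving outwards from the sphere does not increase it. -/
theorem norm_iteratedFDeriv_homExt_le [NeZero d] (ψ : SphTestFn d) (k : ℕ) {x : Rn d}
    (hx : 1 ≤ ‖x‖) :
    ‖iteratedFDeriv ℝ k (homExt ψ) x‖ ≤
      ⨆ w : Sph d, ‖iteratedFDeriv ℝ k (homExt ψ) (w : Rn d)‖ := by
  have hx0 : 0 < ‖x‖ := by linarith
  have hc : 0 < ‖x‖⁻¹ := inv_pos.2 hx0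
  have hs : ‖x‖⁻¹ • x ∈ sphere (0 : Rn d) 1 := by
    rw [mem_sphere_zero_iff_norm, norm_smul, norm_inv, norm_norm, inv_mul_cancel₀ hx0.ne']
  -- Without boundedness the real supremum would take its default value 0; compactness of the sphere
  -- excludes this.
  have hbdd : BddAbove (Set.range fun w : Sph d => ‖iteratedFDeriv ℝ k (homExt ψ) (w : Rn d)‖) := by
    refine (isCompact_range ?_).bddAbove
    refine continuous_iff_continuousAt.2 fun w => ?_
    exact ((continuousAt_iteratedFDeriv_homExt ψ k (ne_zero_of_mem_unit_sphere w)).comp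
      continuous_subtype_val.continuousAt).norm
  refine le_trans ?_ (le_ciSup hbdd ⟨‖x‖⁻¹ • x, hs⟩)
  let g : Rn d ≃L[ℝ] Rn d := ContinuousLinearEquiv.smulLeft (Units.mk0 ‖x‖⁻¹ hc.ne')
  have hg : homExt ψ ∘ g = homExt ψ := funext fun y => homExt_smul ψ hc y
  have h := g.iteratedFDerivWithin_comp_right (homExt ψ) uniqueDiffOn_univ (x := x)
    (Set.mem_univ _) k
  rw [hg, Set.preimage_univ, iteratedFDerivWithin_univ] at h
  rw [h]
  refine (ContinuousMultilinearMap.norm_compContinuousLinearMap_le _ _).trans ?_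
  refine mul_le_of_le_one_right (norm_nonneg _) (Finset.prod_le_one (fun _ _ => norm_nonneg _)
    fun _ _ => ?_)
  refine ContinuousLinearMap.opNorm_le_bound _ zero_le_one fun y => ?_
  change ‖‖x‖⁻¹ • y‖ ≤ 1 * ‖y‖
  rw [norm_smul, norm_inv, norm_norm]
  exact mul_le_mul_of_nonneg_right (inv_le_one_of_one_le₀ hx) (norm_nonneg y)

theorem norm_iteratedFDeriv_homExt_le_sphNorm [NeZero d] (ψ : SphTestFn d) {k N : ℕ} (hk : k ≤ N)
    {x : Rn d} (hx : 1 ≤ ‖x‖) : ‖iteratedFDeriv ℝ k (homExt ψ) x‖ ≤ sphNorm N ψ :=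
  (norm_iteratedFDeriv_homExt_le ψ k hx).trans <|
    Finset.single_le_sum (f := fun k => ⨆ w : Sph d, ‖iteratedFDeriv ℝ k (homExt ψ) (w : Rn d)‖)
      (fun _ _ => Real.iSup_nonneg fun _ => norm_nonneg _)
      (Finset.mem_range.2 (Nat.lt_succ_of_le hk))

theorem homExt_add [NeZero d] (ψ₁ ψ₂ : SphTestFn d) (x : Rn d) :
    homExt (ψ₁ + ψ₂ : SphTestFn d) x = homExt ψ₁ x + homExt ψ₂ x := by
  by_cases hx : x = 0
  · simp [homExt, hx]
  · simp only [homExt, dif_pos hx]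
    rfl

theorem homExt_const_smul [NeZero d] (c : ℝ) (ψ : SphTestFn d) (x : Rn d) :
    homExt (c • ψ : SphTestFn d) x = c * homExt ψ x := by
  by_cases hx : x = 0
  · simp [homExt, hx]
  · simp only [homExt, dif_pos hx]
    rfl

theorem contDiff_mul_homExt [NeZero d] {P : TestFn d} (hP : ∀ x, ‖x‖ < 1 → P x = 0)
    (ψ : SphTestFn d) : ContDiff ℝ ∞ fun x => P x * homExt ψ x := by
  refine contDiff_iff_contDiffAt.2 fun x => ?_
  by_cases hx : x = 0
  · have : (fun x => P x * homExt ψ x) =ᶠ[𝓝 x] fun _ => 0 := by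
      rw [hx]
      filter_upwards [ball_mem_nhds (0 : Rn d) one_pos] with y hy
      rw [hP y (mem_ball_zero_iff.1 hy), zero_mul]
    exact contDiffAt_const.congr_of_eventuallyEq this
  · exact P.contDiff.contDiffAt.mul (contDiffAt_homExt ψ hx)

/-- The linear map `ψ ↦ P(x) ψ(x / ‖x‖)` from `𝒟(𝕊)` to `𝒟(ℝ^d)`, where `P` vanishes in the unit
ball. -/
def mulHomExt [NeZero d] (P : TestFn d) (hP : ∀ x, ‖x‖ < 1 → P x = 0) :
    SphTestFn d →ₗ[ℝ] TestFn d where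
  toFun ψ := mkTest (fun x => P x * homExt ψ x) (contDiff_mul_homExt hP ψ)
    P.hasCompactSupport.isCompact fun _ hx => subset_tsupport _ (left_ne_zero_of_mul hx)
  map_add' ψ₁ ψ₂ := by
    ext x
    change P x * homExt (ψ₁ + ψ₂ : SphTestFn d) x = P x * homExt ψ₁ x + P x * homExt ψ₂ x
    rw [homExt_add, mul_add]
  map_smul' c ψ := by
    ext x
    change P x * homExt (c • ψ : SphTestFn d) x = c * (P x * homExt ψ x)
    rw [homExt_const_smul, mul_left_comm]

theorem mulHomExt_apply [NeZero d] (P : TestFn d) (hP : ∀ x, ‖x‖ < 1 → P x = 0)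
    (ψ : SphTestFn d) (x : Rn d) : mulHomExt P hP ψ x = P x * homExt ψ x :=
  rfl

theorem exists_bound_iteratedFDeriv (P : TestFn d) (N : ℕ) :
    ∃ B, 0 ≤ B ∧ ∀ k ≤ N, ∀ x, ‖iteratedFDeriv ℝ k P x‖ ≤ B := by
  have h (k : ℕ) : ∃ B, ∀ x, ‖iteratedFDeriv ℝ k P x‖ ≤ B :=
    (P.contDiff.continuous_iteratedFDeriv (by exact_mod_cast le_top)).bounded_above_of_compact_support
      (P.hasCompactSupport.iteratedFDeriv k)
  choose B hB using h
  have hB0 (k : ℕ) : 0 ≤ B k := (norm_nonneg _).trans (hB k 0)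
  exact ⟨∑ k ∈ Finset.range (N + 1), B k, Finset.sum_nonneg fun k _ => hB0 k, fun k hk x =>
    (hB k x).trans (Finset.single_le_sum (fun k _ => hB0 k)
      (Finset.mem_range.2 (Nat.lt_succ_of_le hk)))⟩

/-- Only points with `‖x‖ ≥ 1` matter, and there the sphere norms control the homogeneous extension.
The Leibniz rule contributes the sum of the binomial coefficients, at most `2^N`. -/
theorem exists_bound_mulHomExt [NeZero d] (P : TestFn d) (hP : ∀ x, ‖x‖ < 1 → P x = 0) (N : ℕ) :
    ∃ B, 0 ≤ B ∧ ∀ ψ : SphTestFn d, ∀ k ≤ N, ∀ x,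
      ‖iteratedFDeriv ℝ k (mulHomExt P hP ψ) x‖ ≤ B * sphNorm N ψ := by
  obtain ⟨B, hB0, hB⟩ := exists_bound_iteratedFDeriv P N
  refine ⟨2 ^ N * B, by positivity, fun ψ k hk x => ?_⟩
  have hS : 0 ≤ sphNorm N ψ := Finset.sum_nonneg fun _ _ => Real.iSup_nonneg fun _ => norm_nonneg _
  rcases lt_or_ge ‖x‖ 1 with hx | hx
  · have : (mulHomExt P hP ψ : Rn d → ℝ) =ᶠ[𝓝 x] fun _ => 0 := by
      filter_upwards [isOpen_ball.mem_nhds (mem_ball_zero_iff.2 hx)] with y hy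
      rw [mulHomExt_apply, hP y (mem_ball_zero_iff.1 hy), zero_mul]
    rw [(this.iteratedFDeriv ℝ k).eq_of_nhds]
    rw [iteratedFDeriv_fun_zero, Pi.zero_apply, norm_zero]
    positivity
  · have hx0 : x ∈ ({0}ᶜ : Set (Rn d)) := norm_pos_iff.1 (by linarith)
    have ho : IsOpen ({0}ᶜ : Set (Rn d)) := isOpen_compl_singleton
    have hh : ContDiffOn ℝ ∞ (homExt ψ) ({0}ᶜ : Set (Rn d)) :=
      fun y hy => (contDiffAt_homExt ψ hy).contDiffWithinAt
    have h := norm_iteratedFDerivWithin_mul_le P.contDiff.contDiffOn hh ho.uniqueDiffOn hx0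
      (n := k) (by exact_mod_cast le_top)
    simp only [iteratedFDerivWithin_of_isOpen _ ho hx0] at h
    refine h.trans ?_
    have hsum : ∑ i ∈ Finset.range (k + 1), (k.choose i : ℝ) * ‖iteratedFDeriv ℝ i P x‖ *
        ‖iteratedFDeriv ℝ (k - i) (homExt ψ) x‖ ≤
        ∑ i ∈ Finset.range (k + 1), (k.choose i : ℝ) * (B * sphNorm N ψ) := by
      refine Finset.sum_le_sum fun i hi => ?_
      rw [mul_assoc]
      refine mul_le_mul_of_nonneg_left ?_ (Nat.cast_nonneg _)
      have hik : i ≤ k := Nat.lt_succ_iff.1 (Finset.mem_range.1 hi)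
      exact mul_le_mul (hB i (hik.trans hk) x)
        (norm_iteratedFDeriv_homExt_le_sphNorm ψ ((Nat.sub_le k i).trans hk) hx)
        (norm_nonneg _) hB0
    refine hsum.trans ?_
    rw [← Finset.sum_mul, ← Nat.cast_sum, Nat.sum_range_choose, mul_assoc]
    refine mul_le_mul_of_nonneg_right ?_ (by positivity)
    push_cast
    exact pow_le_pow_right₀ one_le_two hk

/-- The distribution on the sphere `ψ ↦ L(P(x) ψ(x / ‖x‖))`. -/
def sphDistrOf [NeZero d] {𝕜 : Type*} [RCLike 𝕜] {L : TestFn d →ₗ[ℝ] 𝕜} (hL : LocallyBounded L)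
    (P : TestFn d) (hP : ∀ x, ‖x‖ < 1 → P x = 0) : SphDistr d 𝕜 where
  toLinearMap := L.comp (mulHomExt P hP)
  continuous' := by
    obtain ⟨N, C, hC, h⟩ := hL (tsupport P) P.hasCompactSupport.isCompact
    obtain ⟨B, hB0, hB⟩ := exists_bound_mulHomExt P hP N
    refine ⟨N, C * B, fun ψ => ?_⟩
    rw [mul_assoc]
    exact h (mulHomExt P hP ψ) (fun x hx => subset_tsupport _ (left_ne_zero_of_mul hx)) _
      (hB ψ) ()

end HomogeneousExtension

/-! ### Euler's equation and radial decomposition of homogeneous functionals. -/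

section Euler

variable {d : ℕ} {𝕜 : Type*} [RCLike 𝕜] {L : TestFn d →ₗ[ℝ] 𝕜}

theorem hasDerivAt_testFn_smul (φ : TestFn d) (x : Rn d) (s : ℝ) :
    HasDerivAt (fun s : ℝ => φ (s • x)) (fderiv ℝ φ (s • x) x) s := by
  have h := ((φ.contDiff.differentiable (by simp)) (s • x)).hasFDerivAt.comp_hasDerivAt
    (f := fun s : ℝ => s • x) s ((hasDerivAt_id s).smul_const x)
  rwa [one_smul] at h

/-- The test function `x ↦ x · ∇φ(x)`. -/
def radialDeriv (φ : TestFn d) : TestFn d :=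
  mkTest (fun x => fderiv ℝ φ x x) ((φ.contDiff.fderiv_right (by simp)).clm_apply contDiff_id)
    φ.hasCompactSupport.isCompact fun x hx => by
      refine support_fderiv_subset ℝ fun h => hx ?_
      simp only [h, zero_apply]

/-- Euler's equation for a functional that is homogeneous of degree `0`. -/
theorem euler_equation (hL : LocallyBounded L)
    (hhom : ∀ t > 0, ∀ φ : TestFn d, L (dilate t φ) = (t ^ d)⁻¹ • L φ) (φ : TestFn d) :
    (d : ℝ) • L φ + L (radialDeriv φ) = 0 := by
  obtain ⟨u, K, hu, hK, huK, hud⟩ := exists_dilate_family φ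
  have hnear : ∀ᶠ t in 𝓝 (1 : ℝ), 1 / 2 < t := lt_mem_nhds (by norm_num)
  have h1 : HasDerivAt (fun t => L (u t)) (L (radialDeriv φ)) 1 := by
    refine hL.hasDerivAt_family hu hK huK fun x => ?_
    have h := hasDerivAt_testFn_smul φ x 1
    rw [one_smul] at h
    refine h.congr_of_eventuallyEq ?_
    filter_upwards [hnear] with t ht
    rw [hud t ht.le, dilate_apply (by linarith)]
  -- By homogeneity `t^d L(φ(t ·))` is constant near `t = 1`; its derivative there is the left side
  -- of Euler's equation.
  have h2 := (hasDerivAt_pow d (1 : ℝ)).smul h1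
  rw [one_pow, one_smul, hud 1 (by norm_num), dilate_one, one_pow, mul_one, add_comm] at h2
  refine (h2.unique ?_)
  refine (hasDerivAt_const (1 : ℝ) (L φ)).congr_of_eventuallyEq ?_
  filter_upwards [hnear] with t ht
  have ht0 : 0 < t := by linarith
  simp only [Pi.smul_apply']
  rw [hud t ht.le, hhom t ht0, smul_smul, mul_inv_cancel₀ (pow_ne_zero d ht0.ne'), one_smul]

theorem contDiff_dilation (φ : TestFn d) : ContDiff ℝ ∞ fun p : ℝ × Rn d => φ (p.1 • p.2) :=
  φ.contDiff.comp (contDiff_fst.smul contDiff_snd)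

/-- The test function `x ↦ χ(x) φ(s x)`. -/
def mulDilate (χ φ : TestFn d) (s : ℝ) : TestFn d :=
  mulTest χ (fun x => φ (s • x)) (φ.contDiff.comp (contDiff_const_smul s))

theorem contDiff_mulDilate (χ φ : TestFn d) :
    ContDiff ℝ ∞ fun p : ℝ × Rn d => mulDilate χ φ p.1 p.2 :=
  (χ.contDiff.comp contDiff_snd).mul (contDiff_dilation φ)

theorem support_mulDilate (χ φ : TestFn d) (s : ℝ) :
    Function.support (mulDilate χ φ s) ⊆ tsupport χ :=
  support_mulTest _ _ _

/-- The product rule gives a term in `L(χ φ(s ·))` and a term in which `φ(s ·)` is differentiated in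
`s`. Euler's equation for `χ φ(s ·)` trades their sum for a single term in which the derivative
falls on `χ`, hence away from the origin when `χ` is constant there. -/
theorem hasDerivAt_pow_smul_mulDilate [NeZero d] (hL : LocallyBounded L)
    (hhom : ∀ t > 0, ∀ φ : TestFn d, L (dilate t φ) = (t ^ d)⁻¹ • L φ) (χ φ : TestFn d) (s : ℝ) :
    HasDerivAt (fun s : ℝ => s ^ d • L (mulDilate χ φ s))
      (s ^ (d - 1) • L (mulDilate (-radialDeriv χ) φ s)) s := by
  let v : TestFn d := mulTest χ (fun x => fderiv ℝ φ (s • x) x)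
    (((φ.contDiff.fderiv_right (m := ∞) (by simp)).comp (contDiff_const_smul s)).clm_apply
      contDiff_id)
  have h1 : HasDerivAt (fun s => L (mulDilate χ φ s)) (L v) s :=
    hL.hasDerivAt_family (contDiff_mulDilate χ φ) χ.hasCompactSupport.isCompact
      (support_mulDilate χ φ) fun x => (hasDerivAt_testFn_smul φ x s).const_mul (χ x)
  have h2 := (hasDerivAt_pow d s).smul h1
  have heuler := euler_equation hL hhom (mulDilate χ φ s)
  have hrad : radialDeriv (mulDilate χ φ s) = s • v - mulDilate (-radialDeriv χ) φ s := by
    ext x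
    change fderiv ℝ (fun x => χ x * φ (s • x)) x x =
      s * (χ x * fderiv ℝ φ (s • x) x) - -(fderiv ℝ χ x x) * φ (s • x)
    have hχ := ((χ.contDiff.differentiable (by simp)) x).hasFDerivAt
    have hφ := ((φ.contDiff.differentiable (by simp)) (s • x)).hasFDerivAt.comp x
      ((hasFDerivAt_id x).const_smul s)
    have hmul := hχ.mul hφ
    rw [show fderiv ℝ (fun x => χ x * φ (s • x)) x = _ from hmul.fderiv]
    simp
    ring
  rw [hrad, map_sub, map_smul] at heuler
  have hQ : L (mulDilate (-radialDeriv χ) φ s) = (d : ℝ) • L (mulDilate χ φ s) + s • L v := by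
    rw [← sub_eq_zero, ← neg_eq_zero, ← heuler]
    abel
  have hval : s ^ (d - 1) • L (mulDilate (-radialDeriv χ) φ s) =
      s ^ d • L v + (d * s ^ (d - 1)) • L (mulDilate χ φ s) := by
    rw [hQ, smul_add, smul_smul, smul_smul, add_comm, mul_comm (d : ℝ), ← pow_succ,
      Nat.sub_add_cancel (NeZero.pos d)]
  rw [hval]
  exact h2

/-- A homogeneous functional as a superposition of its localizations to an annulus. -/
theorem integral_mulDilate [NeZero d] (hL : LocallyBounded L)
    (hhom : ∀ t > 0, ∀ φ : TestFn d, L (dilate t φ) = (t ^ d)⁻¹ • L φ) {χ : TestFn d}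
    (hχ : ∀ x, ‖x‖ ≤ 1 → χ x = 1) {φ : TestFn d} {R : ℝ} (hR : 0 < R)
    (hφ : ∀ x, R < ‖x‖ → φ x = 0) :
    ∫ s in (0 : ℝ)..R, s ^ (d - 1) • L (mulDilate (-radialDeriv χ) φ s) = L φ := by
  have hcont : Continuous fun s : ℝ => s ^ (d - 1) • L (mulDilate (-radialDeriv χ) φ s) :=
    (continuous_id.pow _).smul (hL.continuous_family (contDiff_mulDilate _ φ)
      (-radialDeriv χ).hasCompactSupport.isCompact (support_mulDilate _ φ))
  rw [intervalIntegral.integral_eq_sub_of_hasDerivAt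
    (fun s _ => hasDerivAt_pow_smul_mulDilate hL hhom χ φ s) (hcont.intervalIntegrable _ _)]
  -- At `s = R` the function `φ(R ·)` vanishes outside the unit ball, where `χ = 1`, so homogeneity
  -- yields `L φ`. At `s = 0` the boundary term vanishes because `d ≥ 1`.
  have h : mulDilate χ φ R = dilate R φ := by
    ext x
    rw [dilate_apply hR.ne']
    change χ x * φ (R • x) = φ (R • x)
    by_cases hx : ‖x‖ ≤ 1
    · rw [hχ x hx, one_mul]
    · rw [hφ (R • x), mul_zero]
      rw [norm_smul, Real.norm_of_nonneg hR.le]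
      nlinarith
  rw [h, hhom R hR, smul_smul, mul_inv_cancel₀ (pow_ne_zero d hR.ne'), one_smul,
    zero_pow (NeZero.ne d), zero_smul, sub_zero]

end Euler

/-! ### Representation of homogeneous functionals by distributions on the sphere. -/

section Representation

variable {d : ℕ} [NeZero d] {𝕜 : Type*} [RCLike 𝕜] {L : TestFn d →ₗ[ℝ] 𝕜}

/-- There is a smooth function that equals `1 / ‖x‖` outside of the unit ball. -/
theorem exists_smooth_inv_norm (d : ℕ) :
    ∃ κ : Rn d → ℝ, ContDiff ℝ ∞ κ ∧ ∀ x, 1 ≤ ‖x‖ → κ x = ‖x‖⁻¹ := by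
  let b : ContDiffBump (0 : Rn d) := ⟨1 / 2, 1, by norm_num, by norm_num⟩
  refine ⟨fun x => (1 - b x) * ‖x‖⁻¹, contDiff_iff_contDiffAt.2 fun x => ?_, fun x hx => ?_⟩
  · by_cases hx : x = 0
    · have : (fun x => (1 - b x) * ‖x‖⁻¹) =ᶠ[𝓝 x] fun _ => 0 := by
        rw [hx]
        filter_upwards [closedBall_mem_nhds (0 : Rn d) (by norm_num : (0 : ℝ) < 1 / 2)] with y hy
        rw [b.one_of_mem_closedBall hy, sub_self, zero_mul]
      exact contDiffAt_const.congr_of_eventuallyEq this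
    · exact (contDiffAt_const.sub b.contDiffAt).mul
        ((contDiffAt_norm ℝ hx).inv (norm_ne_zero_iff.2 hx))
  · have : b x = 0 := b.zero_of_le_dist (by simpa using hx)
    simp [this]

theorem homExt_sphRestrict (φ : TestFn d) (r : ℝ) {x : Rn d} (hx : x ≠ 0) :
    homExt (sphRestrict φ r) x = φ (r • ‖x‖⁻¹ • x) := by
  simp only [homExt, dif_pos hx]
  rfl

/-- The substitution `r = s‖x‖` stretches the interval to `[0, R‖x‖]`; the part beyond `R`
contributes nothing since `φ` vanishes there. -/
theorem intervalIntegral_polar (φ : TestFn d) {R : ℝ} (hR : 0 < R)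
    (hφ : ∀ x, R < ‖x‖ → φ x = 0) {x : Rn d} (hx : 1 ≤ ‖x‖) :
    ∫ s in (0 : ℝ)..R, s ^ (d - 1) * φ (s • x) =
      ‖x‖⁻¹ ^ d * ∫ r in (0 : ℝ)..R, r ^ (d - 1) * φ (r • ‖x‖⁻¹ • x) := by
  have hx0 : 0 < ‖x‖ := by linarith
  have hcont : Continuous fun r : ℝ => r ^ (d - 1) * φ (r • ‖x‖⁻¹ • x) := by
    have := φ.continuous
    fun_prop
  have hext : ∫ r in (0 : ℝ)..R, r ^ (d - 1) * φ (r • ‖x‖⁻¹ • x) =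
      ∫ r in (0 : ℝ)..(R * ‖x‖), r ^ (d - 1) * φ (r • ‖x‖⁻¹ • x) := by
    rw [← intervalIntegral.integral_add_adjacent_intervals (hcont.intervalIntegrable 0 R)
      (hcont.intervalIntegrable R (R * ‖x‖))]
    refine (add_eq_left.2 (intervalIntegral.integral_zero_ae ?_)).symm
    refine Eventually.of_forall fun r hr => ?_
    rw [Set.uIoc_of_le (le_mul_of_one_le_right hR.le hx)] at hr
    rw [hφ, mul_zero]
    rw [norm_smul, norm_smul, norm_inv, norm_norm, inv_mul_cancel₀ hx0.ne', mul_one]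
    exact hr.1.trans_le (le_abs_self r)
  have hsub := intervalIntegral.smul_integral_comp_mul_right
    (a := 0) (b := R) (fun r => r ^ (d - 1) * φ (r • ‖x‖⁻¹ • x)) ‖x‖
  rw [zero_mul] at hsub
  rw [hext, ← hsub, smul_eq_mul, ← mul_assoc, ← intervalIntegral.integral_const_mul]
  congr 1
  funext s
  rw [smul_smul, mul_assoc s, mul_inv_cancel₀ hx0.ne', mul_one, mul_pow, inv_pow]
  have hpow : ‖x‖ ^ d = ‖x‖ ^ (d - 1) * ‖x‖ := by
    rw [← pow_succ, Nat.sub_add_cancel (NeZero.pos d)]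
  rw [hpow]
  field_simp

theorem homPairing_eq_intervalIntegral (α : SphDistr d 𝕜) (φ : TestFn d) {R : ℝ} (hR : 0 < R)
    (hφ : ∀ x, R < ‖x‖ → φ x = 0) :
    homPairing α φ =
      ∫ r in (0 : ℝ)..R, r ^ (d - 1) • α.toLinearMap (sphRestrict φ r) := by
  rw [homPairing, intervalIntegral.integral_of_le hR.le]
  refine setIntegral_eq_of_subset_of_forall_sdiff_eq_zero measurableSet_Ioi
    Set.Ioc_subset_Ioi_self fun r hr => ?_
  have hr0 : 0 < r := hr.1
  have hrR : R < r := by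
    by_contra h
    exact hr.2 ⟨hr0, not_lt.1 h⟩
  have : sphRestrict φ r = 0 := by
    ext w
    refine hφ _ ?_
    rw [norm_smul, Real.norm_of_nonneg hr0.le, norm_eq_of_mem_sphere w, mul_one]
    exact hrR
  rw [this, map_zero, smul_zero]

/-- A functional on `𝒟(ℝ^d)` that is homogeneous of degree `0` is given by a distribution on the
sphere. -/
theorem exists_homPairing_eq (hL : LocallyBounded L)
    (hhom : ∀ t > 0, ∀ φ : TestFn d, L (dilate t φ) = (t ^ d)⁻¹ • L φ) :
    ∃ α : SphDistr d 𝕜, ∀ φ, homPairing α φ = L φ := by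
  obtain ⟨χ, -, hχ, -⟩ := exists_cutoff (d := d) 1
  obtain ⟨κ, hκ, hκn⟩ := exists_smooth_inv_norm d
  set Q : TestFn d := -radialDeriv χ with hQdef
  have hQ0 (x : Rn d) (hx : ‖x‖ < 1) : Q x = 0 := by
    have : (χ : Rn d → ℝ) =ᶠ[𝓝 x] fun _ => 1 := by
      filter_upwards [isOpen_ball.mem_nhds (mem_ball_zero_iff.2 hx)] with y hy
      exact hχ y (mem_ball_zero_iff.1 hy).le
    change -(fderiv ℝ χ x x) = 0
    rw [this.fderiv_eq]
    simp
  -- The factor `‖x‖^{-d}` comes from the substitution `r = s‖x‖`; `κ` replaces `‖x‖⁻¹` to stay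
  -- smooth at the origin, harmlessly because `Q` vanishes in the open unit ball.
  let P : TestFn d := mulTest Q (fun x => κ x ^ d) (hκ.pow d)
  have hP0 (x : Rn d) (hx : ‖x‖ < 1) : P x = 0 := by
    change Q x * _ = 0
    rw [hQ0 x hx, zero_mul]
  refine ⟨sphDistrOf hL P hP0, fun φ => ?_⟩
  obtain ⟨R, hR, hφ⟩ := exists_radius φ
  rw [homPairing_eq_intervalIntegral _ φ hR hφ, ← integral_mulDilate hL hhom hχ hR hφ]
  let u : ℝ → TestFn d := fun s => s ^ (d - 1) • mulDilate Q φ s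
  have hu : ContDiff ℝ ∞ fun p : ℝ × Rn d => u p.1 p.2 :=
    (contDiff_fst.pow (d - 1)).mul (contDiff_mulDilate Q φ)
  have huK (s : ℝ) : Function.support (u s) ⊆ tsupport Q := fun x hx =>
    support_mulDilate Q φ s (right_ne_zero_of_mul hx)
  let v : ℝ → TestFn d := fun r => r ^ (d - 1) • mulHomExt P hP0 (sphRestrict φ r)
  -- Writing `κ x • x` for `x/‖x‖` makes the formula valid for all `x` and shows joint smoothness in
  -- `(r, x)`.
  have hv_apply (r : ℝ) (x : Rn d) : v r x = P x * (r ^ (d - 1) * φ (r • κ x • x)) := by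
    change r ^ (d - 1) * (P x * homExt (sphRestrict φ r) x) = _
    rcases lt_or_ge ‖x‖ 1 with hx | hx
    · rw [hP0 x hx, zero_mul, zero_mul, mul_zero]
    · rw [homExt_sphRestrict φ r (norm_pos_iff.1 (by linarith)), hκn x hx]
      ring
  have hv : ContDiff ℝ ∞ fun p : ℝ × Rn d => v p.1 p.2 := by
    simp_rw [hv_apply]
    have hφs := φ.contDiff
    exact (P.contDiff.comp contDiff_snd).mul ((contDiff_fst.pow (d - 1)).mul
      (hφs.comp (contDiff_fst.smul ((hκ.comp contDiff_snd).smul contDiff_snd))))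
  have hvK (s : ℝ) : Function.support (v s) ⊆ tsupport P := fun x hx => by
    rw [Function.mem_support, hv_apply] at hx
    exact subset_tsupport _ (left_ne_zero_of_mul hx)
  -- The families `u` and `v` have the same pointwise integral `I`. Exchanging `L` with each
  -- integral evaluates `L I` in two ways: as the radial decomposition of `L φ` and as the pairing
  -- with the distribution on the sphere.
  let I : TestFn d := mkTest (fun x => ∫ s in (0 : ℝ)..R, u s x)
    ((contDiff_primitive hu 0).comp (contDiff_prodMk_right R)) Q.hasCompactSupport.isCompact
    fun x hx => by
      by_contra hxK
      have (s : ℝ) : u s x = 0 := Function.notMem_support.1 fun h => hxK (huK s h)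
      exact hx (by simp [this])
  have hIv (x : Rn d) : I x = ∫ r in (0 : ℝ)..R, v r x := by
    change ∫ s in (0 : ℝ)..R, s ^ (d - 1) * (Q x * φ (s • x)) = _
    simp_rw [hv_apply, mul_left_comm _ (Q x), intervalIntegral.integral_const_mul]
    change _ = Q x * κ x ^ d * _
    rcases lt_or_ge ‖x‖ 1 with hx | hx
    · rw [hQ0 x hx, zero_mul, zero_mul, zero_mul]
    · rw [intervalIntegral_polar φ hR hφ hx, hκn x hx, mul_assoc]
  have h₁ := hL.map_integral_family hu Q.hasCompactSupport.isCompact huK 0 R (I := I) fun _ => rfl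
  have h₂ := hL.map_integral_family hv P.hasCompactSupport.isCompact hvK 0 R hIv
  simp only [u, map_smul] at h₁
  simp only [v, map_smul] at h₂
  rw [← h₁, h₂]
  rfl

end Representation

end ThickValue

end

theorem proposition6p1 {𝕜 : Type*} [RCLike 𝕜] (d : ℕ) [NeZero d]
    (f : ThickValue.Distr d 𝕜) (x₀ : ThickValue.Rn d) :
    (∃ α : ThickValue.SphDistr d 𝕜, ThickValue.HasThickValue f x₀ α) ↔
      ∀ φ : ThickValue.TestFn d, ThickValue.IsPosNormalized φ →
        ∃ γ : 𝕜, Tendsto (fun n : ℕ => ThickValue.pairTranslate f x₀ (ThickValue.stdDeltaSeq φ n))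
          atTop (𝓝 γ) := by
  constructor
  · rintro ⟨α, hα⟩ φ -
    refine ⟨ThickValue.homPairing α φ, ?_⟩
    have hinv : Tendsto (fun n : ℕ => (n : ℝ)⁻¹) atTop (𝓝[>] 0) :=
      tendsto_inv_atTop_nhdsGT_zero.comp tendsto_natCast_atTop_atTop
    refine ((hα φ).comp hinv).congr fun n => ?_
    rw [Function.comp_apply, ThickValue.pairRescale_inv_natCast,
      ThickValue.deltaSeqFunctional_apply]
  · intro h
    choose γ hγ using ThickValue.exists_limit_of_posNormalized h
    let L : ThickValue.TestFn d →ₗ[ℝ] 𝕜 := linearMapOfTendsto γ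
      (fun n : ℕ => ThickValue.deltaSeqFunctional f x₀ n) (tendsto_pi_nhds.2 hγ)
    have hT : ThickValue.LocallyEquibounded fun n : ℕ => ThickValue.deltaSeqFunctional f x₀ n :=
      ThickValue.LocallyEquibounded.of_pointwise
        (ThickValue.locallyBounded_deltaSeqFunctional f x₀) fun φ => (hγ φ).norm.bddAbove_range
    have hlim : ∀ φ, Tendsto (fun ε => ThickValue.pairRescale f x₀ ε φ) (𝓝[>] 0) (𝓝 (L φ)) :=
      ThickValue.tendsto_pairRescale hγ hT
    obtain ⟨α, hα⟩ := ThickValue.exists_homPairing_eq (hT.locallyBounded_of_tendsto hγ)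
      fun t ht φ => ThickValue.limit_dilate hlim ht φ
    exact ⟨α, fun φ => by rw [hα φ]; exact hlim φ⟩
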